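/- Let $n$ be a nonnegative integer. The $0$-Hecke algebra $H_n(0)$ is the $\mathbb C$-algebra generated by $\pi_1,\dots,\pi_{n-1}$ subject to $\pi_i^2=\pi_i$, $\pi_i\pi_{i+1}\pi_i=\pi_{i+1}\pi_i\pi_{i+1}$ and $\pi_i\pi_j=\pi_j\pi_i$ for $|i-j|\ge 2$. Let $\alpha=(\alpha_1,\dots,\alpha_\ell)$ be a composition of $n$ and $\sigma\in\mathfrak S_\ell$. A standard permuted composition tableau of shape $\alpha$ and type $\sigma$ is a bijective filling $\tau$ with $1,\dots,n$ of the left-justified diagram with $\alpha_i$ boxes in the $i$th row from the top, such that 1. for $i<j$, $\sigma(i)>\sigma(j)$ if and only if $\tau(i,1)>\tau(j,1)$ (the standardization of the first column, read from top to bottom, is $\sigma$); 2. the entries decrease along each row from left to right; 3. if $i<j$ and $\tau(i,k)>\tau(j,k+1)$, then the box $(i,k+1)$ exists and $\tau(i,k+1)>\tau(j,k+1)$. Let $\mathbf S^\sigma_\alpha$ be the $\mathbb C$-vector space with basis the set $\mathrm{SPCT}^\sigma(\alpha)$ of these tableaux. Call $i\in\{1,\dots,n-1\}$ a descent of $\tau$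 if $i+1$ lies in $\tau$ in a column weakly to the right of that of $i$. Say that $i$ and $i+1$ are attacking in $\tau$ if they are in the same column, or if $i+1$ is in the column immediately to the right of that of $i$ and in a strictly lower row. Then $\mathbf S^\sigma_\alpha$ is an $H_n(0)$-module by $$\pi_i\cdot\tau=\begin{cases}\tau & \text{if } i \text{ is not a descent of } \tau,\\ 0 & \text{if } i \text{ is a descent of } \tau \text{ and } i,i+1 \text{ are attacking},\\ s_i\cdot\tau & \text{if } i \text{ is a descent of } \tau \text{ and } i,i+1 \text{ are not attacking},\end{cases}$$ where $s_i\cdot\tau$ is obtained from $\tau$ by swapping $i$ and $i+1$. Call two tableaux in $\mathrm{SPCT}^\sigma(\alpha)$ equivalent if, for every $k$, the words obtained by reading their $k$th columns from top to bottom have the same standardization, and let $\mathcal E^\sigma(\alpha)$ be the set of equivalence classes. For every $E\in\mathcal E^\sigma(\alpha)$ the $\mathbb C$-span $\mathbf S^\sigma_{\alpha,E}$ of $E$ is an $H_n(0)$-submodule of $\mathbf S^\sigma_\alpha$. **Theorem.** For every composition $\alpha$ of $n$, every $\sigma\in\mathfrak S_{\ell(\alpha)}$ and every $E\in\mathcal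 E^\sigma(\alpha)$, the $H_n(0)$-module $\mathbf S^\sigma_{\alpha,E}$ is indecomposable, that is, it is nonzero and is not the direct sum of two nonzero submodules. -/

import Mathlib

noncomputable section

namespace ZeroHecke

/-! ### The 0-Hecke algebra of type A -/

/-- The defining relations of the `0`-Hecke algebra. The free generator indexed by `i : Fin (n - 1)`
(so `0 ≤ i ≤ n - 2`) stands for the generator usually written `π_{i+1}`. -/
inductive Rel (n : ℕ) : FreeAlgebra ℂ (Fin (n - 1)) → FreeAlgebra ℂ (Fin (n - 1)) → Prop
  | idem (i : Fin (n - 1)) :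
      Rel n (FreeAlgebra.ι ℂ i * FreeAlgebra.ι ℂ i) (FreeAlgebra.ι ℂ i)
  | braid (i j : Fin (n - 1)) (h : (j : ℕ) = i + 1) :
      Rel n (FreeAlgebra.ι ℂ i * FreeAlgebra.ι ℂ j * FreeAlgebra.ι ℂ i)
        (FreeAlgebra.ι ℂ j * FreeAlgebra.ι ℂ i * FreeAlgebra.ι ℂ j)
  | comm (i j : Fin (n - 1)) (h : (i : ℕ) + 2 ≤ j) :
      Rel n (FreeAlgebra.ι ℂ i * FreeAlgebra.ι ℂ j) (FreeAlgebra.ι ℂ j * FreeAlgebra.ι ℂ i)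

/-- The `0`-Hecke algebra `H_n(0)` over `ℂ`. -/
abbrev Alg (n : ℕ) : Type := RingQuot (Rel n)

/-- The generators of `H_n(0)`. -/
def gen {n : ℕ} (i : Fin (n - 1)) : Alg n := RingQuot.mkAlgHom ℂ (Rel n) (FreeAlgebra.ι ℂ i)

/-- A module is indecomposable if it is nonzero and is not the (internal) direct sum of two nonzero
submodules. -/
def IsIndecomposable (R M : Type*) [Ring R] [AddCommGroup M] [Module R M] : Prop :=
  Nontrivial M ∧ ∀ p q : Submodule R M, IsCompl p q → p = ⊥ ∨ q = ⊥

/-! ### Standard permuted composition tableaux -/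

variable {n : ℕ}

/-- The boxes of the composition diagram of `α`: row `i` (from the top) has `α_i` boxes.
Rows and columns are counted from `0`. -/
abbrev Box (α : Composition n) : Type := Σ i : Fin α.length, Fin (α.blocksFun i)

namespace Box

variable {α : Composition n}

/-- The row of a box, from the top. -/
def row (b : Box α) : ℕ := b.1

/-- The column of a box, from the left. -/
def col (b : Box α) : ℕ := b.2

/-- The leftmost box of row `i`. -/
def first (α : Composition n) (i : Fin α.length) : Box α := ⟨i, ⟨0, α.one_le_blocksFun i⟩⟩

end Box

/-- Permuted composition tableaux of shape `α` and type `σ`. -/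
structure IsPCT (α : Composition n) (σ : Equiv.Perm (Fin α.length)) (τ : Box α → ℕ) : Prop where
  /-- The entries are positive integers. -/
  pos : ∀ b, 0 < τ b
  /-- The entries in the first column are distinct. -/
  first_injective : Function.Injective fun i => τ (Box.first α i)
  /-- The standardization of the first column word, read from top to bottom, is `σ`. -/
  first_standardization : ∀ i j, i < j →
    (σ j < σ i ↔ τ (Box.first α j) < τ (Box.first α i))
  /-- The rows decrease weakly from left to right. -/
  row_le : ∀ (i : Fin α.length) (k l : Fin (α.blocksFun i)), k ≤ l → τ ⟨i, l⟩ ≤ τ ⟨i, k⟩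
  /-- The triple condition. -/
  triple : ∀ (i j : Fin α.length), i < j →
    ∀ (k : ℕ) (hi : k < α.blocksFun i) (hj : k + 1 < α.blocksFun j),
      τ ⟨j, ⟨k + 1, hj⟩⟩ < τ ⟨i, ⟨k, hi⟩⟩ →
        ∃ h : k + 1 < α.blocksFun i, τ ⟨j, ⟨k + 1, hj⟩⟩ < τ ⟨i, ⟨k + 1, h⟩⟩

/-- Standard permuted composition tableaux of shape `α` and type `σ`. As the diagram of `α` has `n`
boxes, a filling with distinct entries in `{1, …, n}` is a bijection. The element `v : Fin n`
stands for the entry `v + 1`. -/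
@[ext]
structure SPCT (α : Composition n) (σ : Equiv.Perm (Fin α.length)) where
  /-- The filling. -/
  entry : Box α ≃ Fin n
  isPCT : IsPCT α σ fun b => (entry b : ℕ) + 1

/-- The smaller of the two entries moved by the generator `i`. -/
def lo (i : Fin (n - 1)) : Fin n := ⟨i, by omega⟩

/-- The larger of the two entries moved by the generator `i`. -/
def hi (i : Fin (n - 1)) : Fin n := ⟨i + 1, by omega⟩

namespace SPCT

variable {α : Composition n} {σ : Equiv.Perm (Fin α.length)}

/-- The generator index `i` is a descent of `τ`: the larger entry lies weakly right of the
smaller one. -/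
def IsDescent (τ : SPCT α σ) (i : Fin (n - 1)) : Prop :=
  (τ.entry.symm (lo i)).col ≤ (τ.entry.symm (hi i)).col

/-- The entries `u < v` are attacking in `τ`: they are in the same column, or `v` is in the column
next to the right of that of `u`, in a strictly lower row. -/
def IsAttacking (τ : SPCT α σ) (u v : Fin n) : Prop :=
  (τ.entry.symm v).col = (τ.entry.symm u).col ∨
    ((τ.entry.symm v).col = (τ.entry.symm u).col + 1 ∧
      (τ.entry.symm u).row < (τ.entry.symm v).row)

/-- The value at the box `b` of the standardized column word of `τ`: the rank of the entry of `b`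
among the entries of its column. All tableaux of shape `α` have the same column lengths, so two of
them have the same standardized column word if and only if these functions agree. -/
def st (τ : SPCT α σ) (b : Box α) : ℕ :=
  (Finset.univ.filter fun c : Box α => c.col = b.col ∧ τ.entry c ≤ τ.entry b).card

/-- Within a column, `st` orders the boxes as the entries do. -/
theorem st_lt_st_iff (τ : SPCT α σ) {b c : Box α} (h : b.col = c.col) :
    τ.st b < τ.st c ↔ τ.entry b < τ.entry c := by
  have mono : ∀ {b c : Box α}, b.col = c.col → τ.entry b ≤ τ.entry c → τ.st b ≤ τ.st c := by
    intro b c h hle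
    apply Finset.card_le_card
    intro x hx
    simp only [Finset.mem_filter, Finset.mem_univ, true_and] at hx ⊢
    exact ⟨hx.1.trans h, hx.2.trans hle⟩
  constructor
  · intro hlt
    by_contra hge
    exact absurd (mono h.symm (not_lt.mp hge)) (not_le.mpr hlt)
  · intro hlt
    apply Finset.card_lt_card
    rw [Finset.ssubset_iff_of_subset]
    · refine ⟨c, ?_, ?_⟩
      · simp
      · simp [hlt]
    · intro x hx
      simp only [Finset.mem_filter, Finset.mem_univ, true_and] at hx ⊢
      exact ⟨hx.1.trans h, hx.2.trans hlt.le⟩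

/-- Two tableaux are equivalent if they have the same standardized column word. -/
def equivalence (α : Composition n) (σ : Equiv.Perm (Fin α.length)) : Setoid (SPCT α σ) :=
  Setoid.ker st

/-- The set of equivalence classes. -/
def classes (α : Composition n) (σ : Equiv.Perm (Fin α.length)) : Set (Set (SPCT α σ)) :=
  (equivalence α σ).classes

/-- Swapping the two consecutive entries `lo i` and `hi i` in a filling. -/
def swapEntry (i : Fin (n - 1)) (e : Box α ≃ Fin n) : Box α ≃ Fin n :=
  e.trans (Equiv.swap (lo i) (hi i))

/-- The order of two entries changes under the swap only if they are `lo i` and `hi i`. -/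
theorem swap_lt_swap (i : Fin (n - 1)) (u v : Fin n) (h : ¬ (u = lo i ∧ v = hi i))
    (h' : ¬ (u = hi i ∧ v = lo i)) :
    Equiv.swap (lo i) (hi i) u < Equiv.swap (lo i) (hi i) v ↔ u < v := by
  simp only [Equiv.swap_apply_def, Fin.ext_iff, Fin.lt_def, lo, hi] at *
  split_ifs <;> simp <;> omega

theorem entry_swap_lt (τ : SPCT α σ) (i : Fin (n - 1)) (b c : Box α)
    (h : ¬ (b = τ.entry.symm (lo i) ∧ c = τ.entry.symm (hi i)))
    (h' : ¬ (b = τ.entry.symm (hi i) ∧ c = τ.entry.symm (lo i))) :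
    swapEntry i τ.entry b < swapEntry i τ.entry c ↔ τ.entry b < τ.entry c := by
  apply swap_lt_swap
  · simpa only [Equiv.eq_symm_apply] using h
  · simpa only [Equiv.eq_symm_apply] using h'

/-- Swapping nonattacking `i` and `i + 1` for a descent `i` yields a tableau of the same shape and
type. -/
theorem isPCT_swap (τ : SPCT α σ) (i : Fin (n - 1)) (hd : τ.IsDescent i)
    (ha : ¬ τ.IsAttacking (lo i) (hi i)) :
    IsPCT α σ fun b => (swapEntry i τ.entry b : ℕ) + 1 := by
  have key := τ.entry_swap_lt i
  unfold IsDescent at hd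
  unfold IsAttacking at ha
  have hP := τ.isPCT
  have hlh : τ.entry (τ.entry.symm (lo i)) < τ.entry (τ.entry.symm (hi i)) := by
    simp [lo, hi, Fin.lt_def]
  have hsw : swapEntry i τ.entry (τ.entry.symm (hi i)) <
      swapEntry i τ.entry (τ.entry.symm (lo i)) := by
    simp [swapEntry, lo, hi, Fin.lt_def]
  generalize τ.entry.symm (lo i) = p at *
  generalize τ.entry.symm (hi i) = q at *
  have hcol : ∀ b c : Box α, b.col = c.col →
      (swapEntry i τ.entry b < swapEntry i τ.entry c ↔ τ.entry b < τ.entry c) := by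
    intro b c hbc
    apply key
    · rintro ⟨rfl, rfl⟩
      exact ha (Or.inl hbc.symm)
    · rintro ⟨rfl, rfl⟩
      exact ha (Or.inl hbc)
  refine ⟨fun b => Nat.succ_pos _, ?_, ?_, ?_, ?_⟩
  · intro a b hab
    have h1 : swapEntry i τ.entry (Box.first α a) = swapEntry i τ.entry (Box.first α b) := by
      apply Fin.ext
      simpa using hab
    exact congrArg Sigma.fst ((swapEntry i τ.entry).injective h1)
  · intro a b hab
    have h1 := hP.first_standardization a b hab
    have h2 := hcol (Box.first α b) (Box.first α a) rfl
    simp only [Fin.lt_def, Nat.add_lt_add_iff_right] at h1 h2 ⊢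
    rw [h1, h2]
  · intro a k l hkl
    have h1 := hP.row_le a k l hkl
    by_contra hcon
    have h2 := key ⟨a, k⟩ ⟨a, l⟩
    have h3 := hlh
    simp only [Fin.lt_def] at h1 h2 h3 hcon
    by_cases hx : (⟨a, k⟩ : Box α) = p ∧ (⟨a, l⟩ : Box α) = q
    · rw [← hx.1, ← hx.2] at h3
      omega
    · by_cases hy : (⟨a, k⟩ : Box α) = q ∧ (⟨a, l⟩ : Box α) = p
      · rw [← hy.1, ← hy.2] at hd
        have : l ≤ k := hd
        have hkl' : k = l := le_antisymm hkl this
        subst hkl'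
        exact hcon le_rfl
      · have := h2 hx hy
        omega
  · intro a b hab k hk hl hlt
    have h1 := hP.triple a b hab k hk hl
    have hlt' : swapEntry i τ.entry ⟨b, ⟨k + 1, hl⟩⟩ < swapEntry i τ.entry ⟨a, ⟨k, hk⟩⟩ :=
      Nat.lt_of_add_lt_add_right hlt
    have hlt'' : τ.entry ⟨b, ⟨k + 1, hl⟩⟩ < τ.entry ⟨a, ⟨k, hk⟩⟩ := by
      refine (key _ _ ?_ ?_).mp hlt'
      · rintro ⟨rfl, rfl⟩
        exact absurd hd (Nat.not_succ_le_self k)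
      · rintro ⟨rfl, rfl⟩
        exact ha (Or.inr ⟨rfl, hab⟩)
    obtain ⟨h, h2⟩ := h1 (Nat.add_lt_add_right hlt'' 1)
    have h3 := (hcol ⟨b, ⟨k + 1, hl⟩⟩ ⟨a, ⟨k + 1, h⟩⟩ rfl).mpr (Nat.lt_of_add_lt_add_right h2)
    exact ⟨h, Nat.add_lt_add_right h3 1⟩

/-- The tableau `s_i · τ`, for a descent `i` of `τ` such that `i` and `i + 1` are nonattacking. -/
def swap (τ : SPCT α σ) (i : Fin (n - 1)) (hd : τ.IsDescent i)
    (ha : ¬ τ.IsAttacking (lo i) (hi i)) : SPCT α σ where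
  entry := swapEntry i τ.entry
  isPCT := τ.isPCT_swap i hd ha

theorem swap_symm (τ : SPCT α σ) (i : Fin (n - 1)) (hd ha) (v : Fin n) :
    (τ.swap i hd ha).entry.symm v = τ.entry.symm (Equiv.swap (lo i) (hi i) v) := by
  simp [swap, swapEntry]

theorem st_swap (τ : SPCT α σ) (i : Fin (n - 1)) (hd ha) : (τ.swap i hd ha).st = τ.st := by
  funext b
  unfold st
  congr 1
  apply Finset.filter_congr
  intro c _
  refine and_congr_right fun hcb => ?_
  rw [← not_lt, ← not_lt]
  refine not_congr (τ.entry_swap_lt i b c ?_ ?_)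
  · rintro ⟨rfl, rfl⟩
    exact ha (Or.inl hcb)
  · rintro ⟨rfl, rfl⟩
    exact ha (Or.inl hcb.symm)

end SPCT

/-! ### The module spanned by the tableaux -/

/-- The complex vector space with basis the standard permuted composition tableaux of shape `α` and
type `σ`. -/
def TabModule (α : Composition n) (σ : Equiv.Perm (Fin α.length)) : Type := SPCT α σ →₀ ℂ

namespace TabModule

variable (α : Composition n) (σ : Equiv.Perm (Fin α.length))

instance : AddCommGroup (TabModule α σ) := inferInstanceAs (AddCommGroup (SPCT α σ →₀ ℂ))

instance : Module ℂ (TabModule α σ) := inferInstanceAs (Module ℂ (SPCT α σ →₀ ℂ))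

/-- The basis of tableaux. -/
def basis : Module.Basis (SPCT α σ) ℂ (TabModule α σ) :=
  Module.Basis.ofRepr (LinearEquiv.refl ℂ (SPCT α σ →₀ ℂ))

variable {α σ}

open Classical in
/-- The value of the `i`-th generator on a tableau. -/
def opTab (i : Fin (n - 1)) (τ : SPCT α σ) : TabModule α σ :=
  if hd : τ.IsDescent i then
    if ha : τ.IsAttacking (lo i) (hi i) then 0 else basis α σ (τ.swap i hd ha)
  else basis α σ τ

/-- The linear operator by which the `i`-th generator acts. -/
def op (i : Fin (n - 1)) : Module.End ℂ (TabModule α σ) := (basis α σ).constr ℂ (opTab i)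

theorem op_fix (i : Fin (n - 1)) (τ : SPCT α σ) (hd : ¬ τ.IsDescent i) :
    op i (basis α σ τ) = basis α σ τ := by
  simp [op, opTab, hd]

theorem op_zero (i : Fin (n - 1)) (τ : SPCT α σ) (hd : τ.IsDescent i)
    (ha : τ.IsAttacking (lo i) (hi i)) : op i (basis α σ τ) = 0 := by
  simp [op, opTab, hd, ha]

theorem op_swap (i : Fin (n - 1)) (τ : SPCT α σ) (hd : τ.IsDescent i)
    (ha : ¬ τ.IsAttacking (lo i) (hi i)) :
    op i (basis α σ τ) = basis α σ (τ.swap i hd ha) := by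
  simp [op, opTab, hd, ha]

/-- The three cases in the action of a generator on a tableau, in terms of positions. -/
theorem op_cases (i : Fin (n - 1)) {a b : Fin n} (ha : lo i = a) (hb : hi i = b) (τ : SPCT α σ) :
    ((τ.entry.symm b).col < (τ.entry.symm a).col ∧ op i (basis α σ τ) = basis α σ τ) ∨
    (((τ.entry.symm b).col = (τ.entry.symm a).col ∨
      ((τ.entry.symm b).col = (τ.entry.symm a).col + 1 ∧
        (τ.entry.symm a).row < (τ.entry.symm b).row)) ∧ op i (basis α σ τ) = 0) ∨
    (((τ.entry.symm a).col < (τ.entry.symm b).col ∧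
      ¬ ((τ.entry.symm b).col = (τ.entry.symm a).col + 1 ∧
        (τ.entry.symm a).row < (τ.entry.symm b).row)) ∧
      ∃ τ' : SPCT α σ, op i (basis α σ τ) = basis α σ τ' ∧ τ'.st = τ.st ∧
        τ'.entry.symm a = τ.entry.symm b ∧ τ'.entry.symm b = τ.entry.symm a ∧
        ∀ v, v ≠ a → v ≠ b → τ'.entry.symm v = τ.entry.symm v) := by
  subst ha hb
  by_cases hd : τ.IsDescent i
  · by_cases ha : τ.IsAttacking (lo i) (hi i)
    · exact Or.inr (Or.inl ⟨ha, op_zero i τ hd ha⟩)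
    · refine Or.inr (Or.inr ⟨?_, τ.swap i hd ha, op_swap i τ hd ha, τ.st_swap i hd ha, ?_, ?_, ?_⟩)
      · unfold SPCT.IsDescent at hd
        unfold SPCT.IsAttacking at ha
        omega
      · simp [SPCT.swap_symm]
      · simp [SPCT.swap_symm]
      · intro v h1 h2
        rw [SPCT.swap_symm, Equiv.swap_apply_of_ne_of_ne h1 h2]
  · exact Or.inl ⟨not_le.mp hd, op_fix i τ hd⟩

theorem eq_of_symm {τ τ' : SPCT α σ} (h : ∀ v, τ.entry.symm v = τ'.entry.symm v) : τ = τ' := by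
  apply SPCT.ext
  rw [← Equiv.symm_symm τ.entry, ← Equiv.symm_symm τ'.entry]
  exact congrArg Equiv.symm (Equiv.ext h)

theorem op_idem (i : Fin (n - 1)) : op i * op i = (op i : Module.End ℂ (TabModule α σ)) := by
  refine (basis α σ).ext fun τ => ?_
  rw [Module.End.mul_apply]
  rcases op_cases i rfl rfl τ with ⟨_, h⟩ | ⟨_, h⟩ | ⟨hc, τ', h, -, h1, h2, -⟩
  · rw [h, h]
  · rw [h, map_zero]
  · rw [h]
    rcases op_cases i rfl rfl τ' with ⟨_, h'⟩ | ⟨hc', h'⟩ | ⟨hc', _⟩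
    · exact h'
    · rw [h1, h2] at hc'
      omega
    · rw [h1, h2] at hc'
      omega

theorem op_comm (i j : Fin (n - 1)) (hij : (i : ℕ) + 2 ≤ j) :
    op i * op j = (op j * op i : Module.End ℂ (TabModule α σ)) := by
  refine (basis α σ).ext fun τ => ?_
  rw [Module.End.mul_apply, Module.End.mul_apply]
  have n1 : lo i ≠ lo j := by simp only [lo, ne_eq, Fin.ext_iff]; omega
  have n2 : lo i ≠ hi j := by simp only [lo, hi, ne_eq, Fin.ext_iff]; omega
  have n3 : hi i ≠ lo j := by simp only [lo, hi, ne_eq, Fin.ext_iff]; omega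
  have n4 : hi i ≠ hi j := by simp only [hi, ne_eq, Fin.ext_iff]; omega
  have hI := op_cases (σ := σ) (α := α) i rfl rfl
  have hJ := op_cases (σ := σ) (α := α) j rfl rfl
  generalize lo i = a at *
  generalize hi i = b at *
  generalize lo j = c at *
  generalize hi j = d at *
  rcases hI τ with ⟨ci, h⟩ | ⟨ci, h⟩ | ⟨ci, τ₁, h, -, h1, h2, h3⟩ <;>
  rcases hJ τ with ⟨cj, k⟩ | ⟨cj, k⟩ | ⟨cj, τ₂, k, -, k1, k2, k3⟩ <;>
  rw [h, k]
  · exact h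
  · rw [map_zero]
  · have e := hI τ₂
    rw [k3 a n1 n2, k3 b n3 n4] at e
    rcases e with ⟨_, e⟩ | ⟨_, _⟩ | ⟨_, _⟩ <;> first | exact e | omega
  · rw [h, map_zero]
  · simp
  · rw [map_zero]
    have e := hI τ₂
    rw [k3 a n1 n2, k3 b n3 n4] at e
    rcases e with ⟨_, _⟩ | ⟨_, e⟩ | ⟨_, _⟩ <;> first | exact e | omega
  · rw [h]
    have e := hJ τ₁
    rw [h3 c n1.symm n3.symm, h3 d n2.symm n4.symm] at e
    rcases e with ⟨_, e⟩ | ⟨_, _⟩ | ⟨_, _⟩ <;> first | exact e.symm | omega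
  · rw [map_zero]
    have e := hJ τ₁
    rw [h3 c n1.symm n3.symm, h3 d n2.symm n4.symm] at e
    rcases e with ⟨_, _⟩ | ⟨_, e⟩ | ⟨_, _⟩ <;> first | exact e.symm | omega
  · have e := hI τ₂
    rw [k3 a n1 n2, k3 b n3 n4] at e
    have f := hJ τ₁
    rw [h3 c n1.symm n3.symm, h3 d n2.symm n4.symm] at f
    rcases e with ⟨_, e⟩ | ⟨_, e⟩ | ⟨_, τ₃, e, -, e1, e2, e3⟩
    · omega
    · omega
    rcases f with ⟨_, f⟩ | ⟨_, f⟩ | ⟨_, τ₄, f, -, f1, f2, f3⟩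
    · omega
    · omega
    rw [e, f]
    congr 1
    apply eq_of_symm
    intro v
    by_cases va : v = a
    · subst va; rw [e1, f3 _ n1 n2, h1]
    by_cases vb : v = b
    · subst vb; rw [e2, f3 _ n3 n4, h2]
    by_cases vc : v = c
    · subst vc; rw [f1, e3 _ va vb, k1]
    by_cases vd : v = d
    · subst vd; rw [f2, e3 _ va vb, k2]
    rw [e3 v va vb, k3 v vc vd, f3 v vc vd, h3 v va vb]

theorem op_braid (i j : Fin (n - 1)) (hij : (j : ℕ) = i + 1) :
    op i * op j * op i = (op j * op i * op j : Module.End ℂ (TabModule α σ)) := by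
  refine (basis α σ).ext fun τ => ?_
  simp only [Module.End.mul_apply]
  have n1 : lo i ≠ lo j := by simp only [lo, ne_eq, Fin.ext_iff]; omega
  have n2 : lo i ≠ hi j := by simp only [lo, hi, ne_eq, Fin.ext_iff]; omega
  have n3 : lo j ≠ hi j := by simp only [lo, hi, ne_eq, Fin.ext_iff]; omega
  have hI := op_cases (σ := σ) (α := α) i rfl (b := lo j) (by simp only [lo, hi, Fin.ext_iff]; omega)
  have hJ := op_cases (σ := σ) (α := α) j rfl rfl
  generalize lo i = a at *
  generalize lo j = b at *
  generalize hi j = c at *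
  rcases hI τ with ⟨ci, h⟩ | ⟨ci, h⟩ | ⟨ci, τ₁, h, -, h1, h2, h3⟩ <;>
  rcases hJ τ with ⟨cj, k⟩ | ⟨cj, k⟩ | ⟨cj, τ₂, k, -, k1, k2, k3⟩
  · simp only [h, k]
  · simp only [h, k, map_zero]
  · simp only [h, k]
    have e := hI τ₂
    have f := hJ τ₂
    rw [k3 a n1 n2, k1] at e
    rw [k1, k2] at f
    rcases e with ⟨_, e⟩ | ⟨_, e⟩ | ⟨_, τ₃, e, -, e1, e2, e3⟩
    · rcases f with ⟨_, f⟩ | ⟨_, f⟩ | ⟨_, _⟩ <;> first | omega | rw [e, f]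
    · simp only [e, map_zero]
    · have g := hJ τ₃
      rw [e2, e3 c n2.symm n3.symm, k2] at g
      rcases g with ⟨_, g⟩ | ⟨_, g⟩ | ⟨_, _⟩ <;> first | omega | rw [e, g]
  · simp only [h, k, map_zero]
  · simp only [h, k, map_zero]
  · simp only [h, k, map_zero]
    have e := hI τ₂
    rw [k3 a n1 n2, k1] at e
    rcases e with ⟨_, e⟩ | ⟨_, e⟩ | ⟨_, τ₃, e, -, e1, e2, e3⟩
    · omega
    · simp only [e, map_zero]
    · have g := hJ τ₃
      rw [e2, e3 c n2.symm n3.symm, k2] at g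
      rcases g with ⟨_, g⟩ | ⟨_, g⟩ | ⟨_, _⟩ <;> first | omega | rw [e, g]
  · simp only [h, k]
    have e := hI τ₁
    have f := hJ τ₁
    rw [h1, h2] at e
    rw [h2, h3 c n2.symm n3.symm] at f
    rcases f with ⟨_, f⟩ | ⟨_, f⟩ | ⟨_, τ₃, f, -, f1, f2, f3⟩
    · rcases e with ⟨_, e⟩ | ⟨_, e⟩ | ⟨_, _⟩ <;> first | omega | rw [f, e]
    · simp only [f, map_zero]
    · have g := hI τ₃
      rw [f1, f3 a n1 n2, h1] at g
      rcases g with ⟨_, g⟩ | ⟨_, g⟩ | ⟨_, _⟩ <;> first | omega | rw [f, g]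
  · simp only [h, k, map_zero]
    have f := hJ τ₁
    rw [h2, h3 c n2.symm n3.symm] at f
    rcases f with ⟨_, f⟩ | ⟨_, f⟩ | ⟨_, τ₃, f, -, f1, f2, f3⟩
    · omega
    · simp only [f, map_zero]
    · have g := hI τ₃
      rw [f1, f3 a n1 n2, h1] at g
      rcases g with ⟨_, g⟩ | ⟨_, g⟩ | ⟨_, _⟩ <;> first | omega | rw [f, g]
  · simp only [h, k]
    have f := hJ τ₁
    rw [h2, h3 c n2.symm n3.symm] at f
    have e := hI τ₂
    rw [k3 a n1 n2, k1] at e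
    rcases f with ⟨_, f⟩ | ⟨_, f⟩ | ⟨_, τ₃, f, -, f1, f2, f3⟩
    · omega
    · omega
    rcases e with ⟨_, e⟩ | ⟨_, e⟩ | ⟨_, τ₄, e, -, e1, e2, e3⟩
    · omega
    · omega
    rw [e, f]
    have p := hI τ₃
    rw [f1, f3 a n1 n2, h1] at p
    have q := hJ τ₄
    rw [e2, e3 c n2.symm n3.symm, k2] at q
    rcases p with ⟨_, p⟩ | ⟨_, p⟩ | ⟨_, τ₅, p, -, p1, p2, p3⟩
    · omega
    · omega
    rcases q with ⟨_, q⟩ | ⟨_, q⟩ | ⟨_, τ₆, q, -, q1, q2, q3⟩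
    · omega
    · omega
    rw [p, q]
    congr 1
    apply eq_of_symm
    intro v
    by_cases va : v = a
    · subst va; rw [p1, q3 _ n1 n2, e1]
    by_cases vb : v = b
    · subst vb; rw [p2, q1]
    by_cases vc : v = c
    · subst vc; rw [p3 _ va vb, f2, q2]
    rw [p3 v va vb, f3 v vb vc, h3 v va vb, q3 v vb vc, e3 v va vb, k3 v vb vc]

/-- The representation of `H_n(0)` on the span of the tableaux. -/
def rep (α : Composition n) (σ : Equiv.Perm (Fin α.length)) :
    Alg n →ₐ[ℂ] Module.End ℂ (TabModule α σ) :=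
  RingQuot.liftAlgHom ℂ ⟨FreeAlgebra.lift ℂ op, by
    intro x y hxy
    induction hxy with
    | idem i =>
      simp only [map_mul, FreeAlgebra.lift_ι_apply]
      exact op_idem i
    | braid i j h =>
      simp only [map_mul, FreeAlgebra.lift_ι_apply]
      exact op_braid i j h
    | comm i j h =>
      simp only [map_mul, FreeAlgebra.lift_ι_apply]
      exact op_comm i j h⟩

/-- The `H_n(0)`-module structure on the span of the tableaux. -/
instance : Module (Alg n) (TabModule α σ) := Module.compHom _ (rep α σ).toRingHom

theorem smul_def (x : Alg n) (v : TabModule α σ) : x • v = rep α σ x v := rfl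

instance : IsScalarTower ℂ (Alg n) (TabModule α σ) where
  smul_assoc c x v := by simp [smul_def]

theorem gen_smul (i : Fin (n - 1)) (v : TabModule α σ) : gen i • v = op i v := by
  simp [smul_def, gen, rep]

open Classical in
/-- The action of the generators on the basis of tableaux. -/
theorem gen_smul_basis (i : Fin (n - 1)) (τ : SPCT α σ) :
    (gen i : Alg n) • basis α σ τ =
      if hd : τ.IsDescent i then
        if ha : τ.IsAttacking (lo i) (hi i) then 0 else basis α σ (τ.swap i hd ha)
      else basis α σ τ := by
  rw [gen_smul, op, Module.Basis.constr_basis, opTab]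

/-- The complex span of a set of tableaux that is an equivalence class is stable under
the operators of the generators. -/
theorem op_mem_span {E : Set (SPCT α σ)} (hE : E ∈ SPCT.classes α σ) (i : Fin (n - 1))
    {v : TabModule α σ} (hv : v ∈ Submodule.span ℂ (basis α σ '' E)) :
    op i v ∈ Submodule.span ℂ (basis α σ '' E) := by
  induction hv using Submodule.span_induction with
  | mem x hx =>
    obtain ⟨τ, hτ, rfl⟩ := hx
    rcases op_cases i rfl rfl τ with ⟨_, h⟩ | ⟨_, h⟩ | ⟨_, τ', h, hst, -⟩
    · rw [h]
      exact Submodule.subset_span ⟨τ, hτ, rfl⟩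
    · rw [h]
      exact Submodule.zero_mem _
    · rw [h]
      refine Submodule.subset_span ⟨τ', ?_, rfl⟩
      obtain ⟨τ₀, rfl⟩ := hE
      exact hst.trans hτ
  | zero => simp
  | add x y _ _ hx hy =>
    rw [map_add]
    exact Submodule.add_mem _ hx hy
  | smul c x _ hx =>
    rw [map_smul]
    exact Submodule.smul_mem _ c hx

/-- The span of an equivalence class is stable under `H_n(0)`. -/
theorem smul_mem_span {E : Set (SPCT α σ)} (hE : E ∈ SPCT.classes α σ) (x : Alg n)
    {v : TabModule α σ} (hv : v ∈ Submodule.span ℂ (basis α σ '' E)) :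
    x • v ∈ Submodule.span ℂ (basis α σ '' E) := by
  obtain ⟨y, rfl⟩ := RingQuot.mkAlgHom_surjective ℂ (Rel n) x
  induction y using FreeAlgebra.induction generalizing v with
  | grade0 r =>
    rw [AlgHom.commutes, algebraMap_smul]
    exact Submodule.smul_mem _ r hv
  | grade1 i =>
    have h := gen_smul i v
    rw [gen] at h
    rw [h]
    exact op_mem_span hE i hv
  | mul a b ha hb =>
    rw [map_mul, mul_smul]
    exact ha (hb hv)
  | add a b ha hb =>
    rw [map_add, add_smul]
    exact Submodule.add_mem _ (ha hv) (hb hv)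

/-- The `H_n(0)`-submodule whose underlying space is the `ℂ`-span of the equivalence class `E`. -/
def classSubmodule {E : Set (SPCT α σ)} (hE : E ∈ SPCT.classes α σ) :
    Submodule (Alg n) (TabModule α σ) where
  carrier := Submodule.span ℂ (basis α σ '' E)
  add_mem' := Submodule.add_mem _
  zero_mem' := Submodule.zero_mem _
  smul_mem' x _ hv := smul_mem_span hE x hv

end TabModule

end ZeroHecke

end

noncomputable section

namespace ZeroHecke

namespace Box

variable {n : ℕ} {α : Composition n}

/-! Each class contains exactly one source, and this source generates the whole span: every other
tableau of the class is the image under some generator of one with more rising pairs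
(`exists_swap_eq`, `basis_mem_of_isSource`). If the span is `p ⊕ q`, the component `a` in `p` of the
source `τ` is annihilated by everything that annihilates `τ`. It therefore suffices that such an `a`
is a scalar multiple of `τ` (`eq_smul_of_isSource`): then `τ` lies in `p` or in `q`, and that
summand is everything.

For the scalar statement, compare `τ` with the tableaux in the support of `a`, from the largest
entry downwards. If they agree above `m` but some have `m` elsewhere, those have `m` further left
(`IsSource.col_lt`). In `τ` the entry `m` is followed by a stretch of entries returning to its own
column (`exists_stretch`). Moving `m` through this stretch (`exists_moving`) kills every support
tableau with `m` placed as in `τ`, and sends the others to distinct tableaux, so their coefficients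
vanish. -/

theorem ext_row_col {b c : Box α} (hr : b.row = c.row) (hc : b.col = c.col) : b = c := by
  obtain ⟨i, k⟩ := b
  obtain ⟨j, l⟩ := c
  obtain rfl : i = j := Fin.ext hr
  obtain rfl : k = l := Fin.ext hc
  rfl

end Box

/-! ### Tableau conditions in terms of rows and columns of boxes. -/

namespace SPCT

variable {n : ℕ} {α : Composition n} {σ : Equiv.Perm (Fin α.length)}

/-- The box containing the entry `v`. -/
abbrev pos (τ : SPCT α σ) (v : Fin n) : Box α := τ.entry.symm v

theorem entry_lt_of_row (τ : SPCT α σ) {b c : Box α} (hr : b.row = c.row) (hc : b.col < c.col) :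
    τ.entry c < τ.entry b := by
  obtain ⟨i, k⟩ := b
  obtain ⟨j, l⟩ := c
  obtain rfl : i = j := Fin.ext hr
  have h := τ.isPCT.row_le i k l (Fin.le_def.mpr (le_of_lt hc))
  have h' : τ.entry ⟨i, l⟩ ≤ τ.entry ⟨i, k⟩ := Nat.le_of_add_le_add_right h
  refine lt_of_le_of_ne h' fun he => ?_
  rw [τ.entry.injective he] at hc
  exact lt_irrefl _ hc

theorem exists_of_entry_lt (τ : SPCT α σ) {b c : Box α} (hr : b.row < c.row)
    (hc : c.col = b.col + 1) (h : τ.entry c < τ.entry b) :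
    ∃ d : Box α, d.row = b.row ∧ d.col = c.col ∧ τ.entry c < τ.entry d := by
  obtain ⟨i, k, hk⟩ := b
  obtain ⟨j, l, hl⟩ := c
  obtain rfl : l = k + 1 := hc
  obtain ⟨h1, h2⟩ := τ.isPCT.triple i j hr k hk hl (Nat.add_lt_add_right h 1)
  exact ⟨⟨i, k + 1, h1⟩, rfl, rfl, Nat.lt_of_add_lt_add_right h2⟩

theorem exists_left (b : Box α) (h : 0 < b.col) :
    ∃ d : Box α, d.row = b.row ∧ d.col + 1 = b.col := by
  obtain ⟨i, k, hk⟩ := b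
  have h' : 0 < k := h
  refine ⟨⟨i, k - 1, by omega⟩, rfl, ?_⟩
  change k - 1 + 1 = k
  omega

theorem entry_lt_iff_of_st {τ ρ : SPCT α σ} (h : τ.st = ρ.st) {b c : Box α} (hc : b.col = c.col) :
    τ.entry b < τ.entry c ↔ ρ.entry b < ρ.entry c := by
  rw [← τ.st_lt_st_iff hc, ← ρ.st_lt_st_iff hc, h]

instance : Finite (SPCT α σ) :=
  Finite.of_injective SPCT.entry fun _ _ h => SPCT.ext h

/-! ### Source tableaux: comparison within a class, and uniqueness. -/

/-- A tableau is a source if an entry whose successor lies strictly to the left has it as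
its left neighbour. -/
def IsSource (τ : SPCT α σ) : Prop :=
  ∀ a b : Fin n, (b : ℕ) = a + 1 → (τ.pos b).col < (τ.pos a).col →
    (τ.pos b).row = (τ.pos a).row ∧ (τ.pos a).col = (τ.pos b).col + 1

/-- A walk through consecutive entries of a source thus cannot jump leftwards over a column. -/
theorem IsSource.col_le {τ : SPCT α σ} (h : τ.IsSource) {a b : Fin n} (hab : (b : ℕ) = a + 1) :
    (τ.pos a).col ≤ (τ.pos b).col + 1 := by
  by_contra hc
  have := h a b hab (by omega)
  omega

/-- At the largest entry where it differs from another tableau of its class, a source has its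
entry further to the right. -/
theorem IsSource.col_lt {τ ρ : SPCT α σ} (h : τ.IsSource) (hst : τ.st = ρ.st) (m : Fin n)
    (hag : ∀ t, m < t → ρ.pos t = τ.pos t) (hne : ρ.pos m ≠ τ.pos m) :
    (ρ.pos m).col < (τ.pos m).col := by
  have hup : ∀ b, m < ρ.entry b → τ.entry b = ρ.entry b := by
    intro b hb
    have := hag _ hb
    rw [pos, Equiv.symm_apply_apply] at this
    rw [← Equiv.eq_symm_apply]
    exact this
  have hup' : ∀ b, τ.entry b ≤ m → ρ.entry b ≤ m := by
    intro b hb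
    by_contra hc
    rw [hup b (not_le.mp hc)] at hb
    exact hc hb
  have hjm : τ.entry (ρ.pos m) < m := by
    refine lt_of_le_of_ne ?_ fun he => hne ((Equiv.eq_symm_apply _).mpr he)
    by_contra hc
    have h1 := hag _ (not_le.mp hc)
    simp only [pos, Equiv.symm_apply_apply, EmbeddingLike.apply_eq_iff_eq] at h1
    have h2 := not_le.mp hc
    rw [h1] at h2
    exact lt_irrefl _ h2
  -- Equal standardizations would make the box of such a `t` carry an entry above `m` in `ρ`,
  -- contrary to `hup'`.
  have hcol : ∀ t : Fin n, τ.entry (ρ.pos m) < t → t ≤ m → (τ.pos t).col ≠ (ρ.pos m).col := by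
    intro t h1 h2 hc
    have h3 := (entry_lt_iff_of_st hst (b := ρ.pos m) (c := τ.pos t) hc.symm).mp (by simpa using h1)
    have h4 := hup' (τ.pos t) (by simpa using h2)
    simp only [pos, Equiv.apply_symm_apply] at h3 h4
    exact absurd h3 (not_lt.mpr h4)
  -- The walk in `τ` from the entry in the box `ρ.pos m` up to `m` never re-enters this column. Once
  -- to its right it stays there, since it cannot jump over the column.
  have key : ∀ d : ℕ, ∀ t : Fin n, (t : ℕ) = τ.entry (ρ.pos m) + 1 + d → t ≤ m →
      (ρ.pos m).col < (τ.pos t).col := by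
    intro d
    induction d with
    | zero =>
      intro t ht htm
      have h1 := hcol t (by rw [Fin.lt_def]; omega) htm
      have h2 := h (τ.entry (ρ.pos m)) t ht
      simp only [pos, Equiv.symm_apply_apply] at h2
      by_contra hc
      -- If the walk began with a step to the left neighbour, row decrease in `ρ` would force an
      -- entry above `m` into that box.
      obtain ⟨h3, h4⟩ := h2 (by simp only [pos] at *; omega)
      have h5 := ρ.entry_lt_of_row (b := τ.pos t) (c := ρ.pos m) h3 (by simp only [pos] at *; omega)
      have h6 := hup' (τ.pos t) (by simpa using htm)
      simp only [pos, Equiv.apply_symm_apply] at h5 h6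
      exact absurd h5 (not_lt.mpr h6)
    | succ d ih =>
      intro t ht htm
      have htn := t.isLt
      have h1 := ih ⟨t - 1, by omega⟩ (by simp only; omega)
        (by rw [Fin.le_def] at *; simp only; omega)
      have h2 := h.col_le (a := ⟨t - 1, by omega⟩) (b := t) (by simp only; omega)
      have h3 := hcol t (by rw [Fin.lt_def]; omega) htm
      omega
  exact key (m - (τ.entry (ρ.pos m) + 1)) m (by rw [Fin.lt_def] at hjm; omega) le_rfl

/-- A class contains at most one source. -/
theorem IsSource.unique {τ ρ : SPCT α σ} (h : τ.IsSource) (h' : ρ.IsSource) (hst : τ.st = ρ.st) :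
    τ = ρ := by
  by_contra hne
  have hex : ∃ d : ℕ, ∃ v : Fin n, n - v = d ∧ ρ.pos v ≠ τ.pos v := by
    by_contra hc
    push Not at hc
    exact hne (TabModule.eq_of_symm fun v => (hc _ v rfl).symm)
  classical
  obtain ⟨m, hm, hmne⟩ := Nat.find_spec hex
  have hag : ∀ t, m < t → ρ.pos t = τ.pos t := by
    intro t ht
    by_contra hc
    refine Nat.find_min hex (m := n - t) ?_ ⟨t, rfl, hc⟩
    have := t.isLt
    rw [Fin.lt_def] at ht
    omega
  -- At the largest entry where they differ, each source would have its entry strictly right of the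
  -- other's.
  have h1 := h.col_lt hst m hag hmne
  have h2 := h'.col_lt hst.symm m (fun t ht => (hag t ht).symm) hmne.symm
  omega

/-- In a source, an entry `m` outside the first column whose successor lies weakly to the right is
followed by a stretch of entries weakly to its right that ends in its own column and has
entries in this column only in higher rows. -/
theorem IsSource.exists_stretch {τ : SPCT α σ} (h : τ.IsSource) (m : Fin n)
    (hk : 0 < (τ.pos m).col)
    (hd : ∀ t : Fin n, (t : ℕ) = m + 1 → (τ.pos m).col ≤ (τ.pos t).col) :
    ∃ s : Fin n, m < s ∧ (τ.pos s).col = (τ.pos m).col ∧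
      ∀ t, m < t → t ≤ s → (τ.pos m).col ≤ (τ.pos t).col ∧
        ((τ.pos t).col = (τ.pos m).col → (τ.pos t).row < (τ.pos m).row) := by
  obtain ⟨x', hr, hc⟩ := exists_left _ hk
  have hp : m < τ.entry x' := by
    simpa using τ.entry_lt_of_row hr (by omega)
  -- The first entry `q` after `m` lying strictly left of its column ends the stretch; the left
  -- neighbour `x'` of `m` shows that one exists.
  have hex : ∃ q : ℕ, ∃ h : q < n, (m : ℕ) < q ∧ (τ.pos ⟨q, h⟩).col < (τ.pos m).col := by
    refine ⟨τ.entry x', (τ.entry x').isLt, hp, ?_⟩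
    simp only [pos, Fin.eta, Equiv.symm_apply_apply] at *
    omega
  classical
  obtain ⟨hq, hmq, hqc⟩ := Nat.find_spec hex
  have hmin : ∀ t : Fin n, m < t → (t : ℕ) < Nat.find hex → (τ.pos m).col ≤ (τ.pos t).col := by
    intro t h1 h2
    by_contra hcon
    exact Nat.find_min hex h2 ⟨t.isLt, h1, not_le.mp hcon⟩
  have hle : Nat.find hex ≤ τ.entry x' := by
    refine Nat.find_min' hex ⟨(τ.entry x').isLt, hp, ?_⟩
    simp only [pos, Fin.eta, Equiv.symm_apply_apply] at *
    omega
  generalize Nat.find hex = q at *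
  have hq2 : (m : ℕ) + 1 < q := by
    by_contra hcon
    have := hd ⟨q, hq⟩ (by simp only; omega)
    omega
  let s : Fin n := ⟨q - 1, by omega⟩
  have hms : m < s := by rw [Fin.lt_def]; simp only [s]; omega
  have hs := hmin s hms (by simp only [s]; omega)
  -- The step from `s` to `q` goes left, hence by exactly one column. As it leaves the region weakly
  -- right of `m`, it starts in the column of `m`.
  obtain ⟨hs1, hs2⟩ := h s ⟨q, hq⟩ (by simp only [s]; omega) (by omega)
  have hqx : (q : ℕ) < τ.entry x' := by
    refine lt_of_le_of_ne hle fun he => ?_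
    have h1 : τ.pos ⟨q, hq⟩ = x' := (Equiv.symm_apply_eq _).mpr (Fin.ext he)
    rw [h1] at hs1 hs2
    have h2 : τ.pos s = τ.pos m := Box.ext_row_col (by omega) (by omega)
    exact hms.ne' (τ.entry.symm.injective h2)
  refine ⟨s, hms, by omega, fun t h1 h2 => ⟨hmin t h1 ?_, fun h3 => ?_⟩⟩
  · rw [Fin.le_def] at h2
    simp only [s] at h2
    omega
  · by_contra hcon
    rcases lt_or_eq_of_le (not_lt.mp hcon) with h4 | h4
    · have h5 : τ.entry (τ.pos t) < τ.entry x' := by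
        rw [Fin.lt_def]
        rw [Fin.le_def] at h2
        simp only [pos, Equiv.apply_symm_apply, s] at h2 ⊢
        omega
      obtain ⟨d, d1, d2, d3⟩ := τ.exists_of_entry_lt (b := x') (c := τ.pos t) (by omega) (by omega) h5
      have h6 : d = τ.pos m := Box.ext_row_col (by omega) (by omega)
      subst h6
      simp only [pos, Equiv.apply_symm_apply] at d3
      exact absurd h1 (not_lt.mpr d3.le)
    · exact h1.ne (τ.entry.symm.injective (Box.ext_row_col h4 h3.symm))

/-! ### Existence of sources by undoing swaps. -/

/-- The pairs of boxes in different columns with the larger entry on the right. -/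
def risingPairs (τ : SPCT α σ) : Finset (Box α × Box α) :=
  Finset.univ.filter fun x => x.1.col < x.2.col ∧ τ.entry x.1 < τ.entry x.2

/-- A tableau that is not a source arises from another one by a generator. -/
theorem exists_swap_eq (τ : SPCT α σ) (h : ¬ τ.IsSource) :
    ∃ (ρ : SPCT α σ) (i : Fin (n - 1)) (hd : ρ.IsDescent i)
      (ha : ¬ ρ.IsAttacking (lo i) (hi i)), ρ.swap i hd ha = τ ∧
        τ.risingPairs.card < ρ.risingPairs.card := by
  unfold IsSource at h
  push Not at h
  obtain ⟨a, b, hab, hcol, hadj⟩ := h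
  have hbn := b.isLt
  let i : Fin (n - 1) := ⟨a, by omega⟩
  have hai : a = lo i := rfl
  have hbi : b = hi i := Fin.ext hab
  rw [hai, hbi] at hcol hadj
  clear_value i
  clear hai hbi hab hbn a b
  have key := τ.entry_swap_lt i
  have hep : τ.entry (τ.pos (lo i)) = lo i := Equiv.apply_symm_apply _ _
  have heq : τ.entry (τ.pos (hi i)) = hi i := Equiv.apply_symm_apply _ _
  have hlh : ∀ c : Box α, lo i < τ.entry c → ¬ τ.entry c < hi i := by
    intro c h1 h2
    simp only [Fin.lt_def, lo, hi] at h1 h2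
    omega
  have hlt : τ.entry (τ.pos (lo i)) < τ.entry (τ.pos (hi i)) := by
    rw [hep, heq]
    simp [lo, hi, Fin.lt_def]
  have hswl : swapEntry i τ.entry (τ.pos (lo i)) = hi i := by simp [swapEntry]
  have hswh : swapEntry i τ.entry (τ.pos (hi i)) = lo i := by simp [swapEntry]
  have hsw : swapEntry i τ.entry (τ.pos (hi i)) < swapEntry i τ.entry (τ.pos (lo i)) := by
    rw [hswl, hswh]
    simp [lo, hi, Fin.lt_def]
  have hsl : (swapEntry i τ.entry).symm (lo i) = τ.pos (hi i) := by
    rw [Equiv.symm_apply_eq, hswh]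
  have hsh : (swapEntry i τ.entry).symm (hi i) = τ.pos (lo i) := by
    rw [Equiv.symm_apply_eq, hswl]
  -- The triple condition together with row decrease would produce an entry strictly between `lo i`
  -- and `hi i`.
  have hattack : (τ.pos (lo i)).col = (τ.pos (hi i)).col + 1 →
      ¬ (τ.pos (hi i)).row < (τ.pos (lo i)).row := by
    intro h1 h2
    obtain ⟨d, d1, d2, d3⟩ := τ.exists_of_entry_lt h2 h1 hlt
    have h3 := τ.entry_lt_of_row (b := τ.pos (hi i)) (c := d) d1.symm (by omega)
    rw [hep] at d3
    rw [heq] at h3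
    exact hlh d d3 h3
  -- In a common row the two boxes are not adjacent, and the left neighbour of the box of `lo i`
  -- would hold an entry strictly between them.
  have hrow : (τ.pos (hi i)).row ≠ (τ.pos (lo i)).row := by
    intro hr
    have h1 := hadj hr
    obtain ⟨d, d1, d2⟩ := exists_left (τ.pos (lo i)) (by omega)
    have h2 := τ.entry_lt_of_row (b := d) (c := τ.pos (lo i)) d1 (by omega)
    have h3 := τ.entry_lt_of_row (b := τ.pos (hi i)) (c := d) (by omega) (by omega)
    rw [hep] at h2
    rw [heq] at h3
    exact hlh d h2 h3
  have hpq : ∀ b c : Box α, b.col = c.col →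
      (swapEntry i τ.entry b < swapEntry i τ.entry c ↔ τ.entry b < τ.entry c) := by
    intro b c hbc
    apply key
    · rintro ⟨rfl, rfl⟩
      exact absurd hbc hcol.ne'
    · rintro ⟨rfl, rfl⟩
      exact absurd hbc hcol.ne
  have hP : IsPCT α σ fun b => (swapEntry i τ.entry b : ℕ) + 1 := by
    refine ⟨fun b => Nat.succ_pos _, ?_, ?_, ?_, ?_⟩
    · intro a b hab
      have h1 : swapEntry i τ.entry (Box.first α a) = swapEntry i τ.entry (Box.first α b) :=
        Fin.ext (by simpa using hab)
      exact congrArg Sigma.fst ((swapEntry i τ.entry).injective h1)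
    · intro a b hab
      have h1 := τ.isPCT.first_standardization a b hab
      have h2 := hpq (Box.first α b) (Box.first α a) rfl
      simp only [Fin.lt_def, Nat.add_lt_add_iff_right] at h1 h2 ⊢
      rw [h1, h2]
    · intro a k l hkl
      rcases hkl.eq_or_lt with rfl | hkl
      · exact le_rfl
      · have h1 := τ.entry_lt_of_row (b := ⟨a, k⟩) (c := ⟨a, l⟩) rfl hkl
        refine Nat.add_le_add_right (le_of_lt ((key ⟨a, l⟩ ⟨a, k⟩ ?_ ?_).mpr h1)) 1
        · rintro ⟨h2, h3⟩
          apply hrow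
          rw [pos, pos, ← h2, ← h3]
          rfl
        · rintro ⟨h2, h3⟩
          apply hrow
          rw [pos, pos, ← h2, ← h3]
          rfl
    · intro a b hab k hk hl hlt'
      have h1 : τ.entry ⟨b, ⟨k + 1, hl⟩⟩ < τ.entry ⟨a, ⟨k, hk⟩⟩ := by
        have h0 : swapEntry i τ.entry ⟨b, ⟨k + 1, hl⟩⟩ < swapEntry i τ.entry ⟨a, ⟨k, hk⟩⟩ :=
          Nat.lt_of_add_lt_add_right hlt'
        refine (key _ _ ?_ ?_).mp h0
        · rintro ⟨h2, h3⟩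
          rw [h2, h3] at h0
          exact absurd h0 hsw.le.not_gt
        · rintro ⟨h2, h3⟩
          rw [pos, pos, ← h2, ← h3] at hcol
          exact absurd hcol (Nat.not_lt.mpr (Nat.le_succ k))
      obtain ⟨h2, h3⟩ := τ.isPCT.triple a b hab k hk hl (Nat.add_lt_add_right h1 1)
      exact ⟨h2, Nat.add_lt_add_right
        ((hpq ⟨b, ⟨k + 1, hl⟩⟩ ⟨a, ⟨k + 1, h2⟩⟩ rfl).mpr (Nat.lt_of_add_lt_add_right h3)) 1⟩
  refine ⟨⟨swapEntry i τ.entry, hP⟩, i, ?_, ?_, ?_, ?_⟩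
  · unfold IsDescent
    rw [hsl, hsh]
    exact hcol.le
  · unfold IsAttacking
    rw [hsl, hsh]
    rintro (h1 | ⟨h1, h2⟩)
    · exact hcol.ne' h1
    · exact hattack h1 h2
  · apply SPCT.ext
    ext b
    simp [swap, swapEntry]
  · apply Finset.card_lt_card
    rw [Finset.ssubset_iff_of_subset]
    -- The swapped pair becomes rising, while every pair rising in `τ` stays so.
    · refine ⟨(τ.pos (hi i), τ.pos (lo i)), ?_, ?_⟩
      · simp only [risingPairs, Finset.mem_filter, Finset.mem_univ, true_and]
        exact ⟨hcol, hsw⟩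
      · simp only [risingPairs, Finset.mem_filter, Finset.mem_univ, true_and]
        exact fun h1 => absurd h1.2 hlt.le.not_gt
    · rintro ⟨b, c⟩ hx
      simp only [risingPairs, Finset.mem_filter, Finset.mem_univ, true_and] at hx ⊢
      refine ⟨hx.1, (key b c ?_ ?_).mpr hx.2⟩
      · rintro ⟨rfl, rfl⟩
        exact absurd hx.1 hcol.le.not_gt
      · rintro ⟨rfl, rfl⟩
        exact absurd hx.2 hlt.le.not_gt

/-- A member of the finite class with the most rising pairs cannot arise from another by a swap. -/
theorem exists_isSource (τ : SPCT α σ) : ∃ ρ : SPCT α σ, ρ.IsSource ∧ ρ.st = τ.st := by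
  obtain ⟨ρ, hρ, hmax⟩ := Set.exists_max_image {ρ : SPCT α σ | ρ.st = τ.st}
    (fun ρ => ρ.risingPairs.card) (Set.toFinite _) ⟨τ, rfl⟩
  refine ⟨ρ, ?_, hρ⟩
  by_contra hs
  obtain ⟨ρ', i, hd, ha, h1, h2⟩ := ρ.exists_swap_eq hs
  have h3 : ρ'.st = τ.st := by
    rw [← ρ'.st_swap i hd ha, h1]
    exact hρ
  exact absurd h2 (not_lt.mpr (hmax ρ' h3))

end SPCT

/-! ### Action on the source and on vectors sharing its annihilators. -/

namespace TabModule

open SPCT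

variable {n : ℕ} {α : Composition n} {σ : Equiv.Perm (Fin α.length)}

/-- A source generates the span of its class. -/
theorem basis_mem_of_isSource {τ : SPCT α σ} (h : τ.IsSource)
    (N : Submodule (Alg n) (TabModule α σ)) (hN : basis α σ τ ∈ N) (ρ : SPCT α σ)
    (hρ : ρ.st = τ.st) : basis α σ ρ ∈ N := by
  by_contra hcon
  -- A missing tableau with the most rising pairs is either the source itself or the image of a
  -- tableau already in `N`.
  obtain ⟨ρ, ⟨hρ, hcon⟩, hmax⟩ := Set.exists_max_image
    {ρ : SPCT α σ | ρ.st = τ.st ∧ basis α σ ρ ∉ N}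
    (fun ρ => ρ.risingPairs.card) (Set.toFinite _) ⟨ρ, hρ, hcon⟩
  by_cases hs : ρ.IsSource
  · rw [h.unique hs hρ.symm] at hN
    exact hcon hN
  · obtain ⟨ρ', i, hd, ha, h1, h2⟩ := ρ.exists_swap_eq hs
    have h3 : ρ'.st = τ.st := by
      rw [← ρ'.st_swap i hd ha, h1]
      exact hρ
    have h4 : basis α σ ρ' ∈ N := by
      by_contra h4
      exact absurd h2 (not_lt.mpr (hmax ρ' ⟨h3, h4⟩))
    refine hcon ?_
    rw [← h1, ← op_swap i ρ' hd ha, ← gen_smul]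
    exact N.smul_mem _ h4

/-- The support of a vector fixed by a generator consists of tableaux without the
corresponding descent. -/
theorem not_isDescent_of_op_eq {i : Fin (n - 1)} {v : TabModule α σ} (hv : op i v = v)
    {τ : SPCT α σ} (hτ : (basis α σ).repr v τ ≠ 0) : ¬ τ.IsDescent i := by
  classical
  intro hd
  apply hτ
  -- The image of `op i` is spanned by tableaux without this descent, since a swap destroys it.
  have hzero : (basis α σ).coord τ ∘ₗ op i = 0 := by
    refine (basis α σ).ext fun ρ => ?_
    have hne : ∀ ρ' : SPCT α σ, ¬ ρ'.IsDescent i → (basis α σ).coord τ (basis α σ ρ') = 0 := by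
      intro ρ' h'
      rw [Module.Basis.coord_apply, Module.Basis.repr_self, Finsupp.single_apply, if_neg]
      rintro rfl
      exact h' hd
    rw [LinearMap.comp_apply, LinearMap.zero_apply]
    by_cases h1 : ρ.IsDescent i
    · by_cases h2 : ρ.IsAttacking (lo i) (hi i)
      · rw [op_zero i ρ h1 h2, map_zero]
      · rw [op_swap i ρ h1 h2]
        refine hne _ fun h3 => ?_
        unfold IsDescent at h3
        rw [swap_symm, swap_symm, Equiv.swap_apply_left, Equiv.swap_apply_right] at h3
        unfold IsAttacking at h2
        unfold IsDescent at h1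
        exact h2 (Or.inl (le_antisymm h3 h1))
    · rw [op_fix i ρ h1]
      exact hne ρ h1
  have := LinearMap.congr_fun hzero v
  rw [LinearMap.comp_apply, hv] at this
  exact this

/-- The product of generators that moves the entry `m` past the entries `m + 1, …, m + j`, one
after the other. -/
theorem exists_moving (α : Composition n) (σ : Equiv.Perm (Fin α.length)) (m : Fin n) (j : ℕ)
    (hj : (m : ℕ) + j < n) :
    ∃ (x : Alg n) (g : Equiv.Perm (Fin n)), g m = ⟨m + j, hj⟩ ∧
      (∀ t : Fin n, (m : ℕ) + j < t → g t = t) ∧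
      (∀ τ : SPCT α σ, (∀ t : Fin n, m < t → (t : ℕ) ≤ m + j →
          (τ.pos m).col ≤ (τ.pos t).col ∧ ¬ τ.IsAttacking m t) →
        ∃ τ' : SPCT α σ, x • basis α σ τ = basis α σ τ' ∧ τ'.entry = τ.entry.trans g) ∧
      (∀ τ : SPCT α σ, (∀ t : Fin n, m < t → (t : ℕ) ≤ m + j →
          (τ.pos m).col ≤ (τ.pos t).col) →
        (∃ t : Fin n, m < t ∧ (t : ℕ) ≤ m + j ∧ τ.IsAttacking m t) → x • basis α σ τ = 0) := by
  induction j with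
  | zero =>
    refine ⟨1, 1, rfl, fun _ _ => rfl, fun τ _ => ⟨τ, one_smul _ _, rfl⟩, ?_⟩
    rintro τ - ⟨t, h1, h2, -⟩
    rw [Fin.lt_def] at h1
    omega
  | succ j ih =>
    obtain ⟨x, g, hgm, hgt, hswap, hzero⟩ := ih (by omega)
    -- After `j` moves the original box of `m` holds `m + j`, and larger entries have not moved. The
    -- next generator therefore compares that box with the original box of `m + j + 1`.
    let i : Fin (n - 1) := ⟨m + j, by omega⟩
    have hlo : lo i = g m := hgm.symm
    have hhi : hi i = ⟨m + (j + 1), hj⟩ := rfl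
    have hfix : g (hi i) = hi i := hgt _ (by simp only [hi, i]; omega)
    have hpos : ∀ τ τ' : SPCT α σ, τ'.entry = τ.entry.trans g →
        τ'.entry.symm (lo i) = τ.pos m ∧ τ'.entry.symm (hi i) = τ.pos (hi i) := by
      intro τ τ' h
      constructor
      · rw [Equiv.symm_apply_eq, h, hlo]
        simp
      · rw [Equiv.symm_apply_eq, h]
        simp [hfix]
    refine ⟨gen i * x, g.trans (Equiv.swap (lo i) (hi i)), ?_, ?_, ?_, ?_⟩
    · rw [Equiv.trans_apply, ← hlo, Equiv.swap_apply_left, hhi]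
    · intro t ht
      rw [Equiv.trans_apply, hgt t (by omega), Equiv.swap_apply_of_ne_of_ne]
      · rintro rfl
        simp only [lo, i] at ht
        omega
      · rintro rfl
        simp only [hi, i] at ht
        omega
    · intro τ hτ
      obtain ⟨τ', h1, h2⟩ := hswap τ fun t a b => hτ t a (by omega)
      obtain ⟨h3, h4⟩ := hpos τ τ' h2
      obtain ⟨h5, h6⟩ := hτ (hi i) (by simp only [hi, i, Fin.lt_def]; omega)
        (by simp only [hi, i]; omega)
      have hd : τ'.IsDescent i := by
        unfold IsDescent
        rw [h3, h4]
        exact h5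
      have ha : ¬ τ'.IsAttacking (lo i) (hi i) := by
        unfold IsAttacking
        rw [h3, h4]
        exact h6
      refine ⟨τ'.swap i hd ha, ?_, ?_⟩
      · rw [mul_smul, h1, gen_smul, op_swap i τ' hd ha]
      · simp only [SPCT.swap, swapEntry, h2]
        rfl
    · intro τ hτ hex
      by_cases hex' : ∃ t : Fin n, m < t ∧ (t : ℕ) ≤ m + j ∧ τ.IsAttacking m t
      · rw [mul_smul, hzero τ (fun t a b => hτ t a (by omega)) hex', smul_zero]
      · push Not at hex'
        obtain ⟨t, ht1, ht2, ht3⟩ := hex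
        obtain rfl : t = hi i := by
          apply Fin.ext
          by_contra hne
          refine hex' t ht1 ?_ ht3
          simp only [hi, i] at hne
          omega
        obtain ⟨τ', h1, h2⟩ := hswap τ fun t a b => ⟨hτ t a (by omega), hex' t a b⟩
        obtain ⟨h3, h4⟩ := hpos τ τ' h2
        have h5 := hτ (hi i) ht1 ht2
        rw [mul_smul, h1, gen_smul]
        refine op_zero i τ' ?_ ?_
        · unfold IsDescent
          rw [h3, h4]
          exact h5
        · unfold IsAttacking
          rw [h3, h4]
          exact ht3

/-- A vector of the class of a source that is annihilated by all elements annihilating the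
source and fixed by all generators fixing the source is a multiple of the source. -/
theorem eq_smul_of_isSource {τ : SPCT α σ} (h : τ.IsSource) {v : TabModule α σ}
    (hsupp : ∀ ρ, (basis α σ).repr v ρ ≠ 0 → ρ.st = τ.st)
    (hann : ∀ x : Alg n, x • basis α σ τ = 0 → x • v = 0)
    (hfix : ∀ i : Fin (n - 1), op i (basis α σ τ) = basis α σ τ → op i v = v) :
    ∃ c : ℂ, v = c • basis α σ τ := by
  -- Strong induction on `n - m` runs through the entries from the largest downwards.
  have hagree : ∀ d : ℕ, ∀ m : Fin n, n - (m : ℕ) = d →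
      ∀ ρ, (basis α σ).repr v ρ ≠ 0 → ρ.pos m = τ.pos m := by
    intro d
    induction d using Nat.strong_induction_on with
    | _ d ih =>
      intro m hm
      have hag : ∀ ρ, (basis α σ).repr v ρ ≠ 0 → ∀ t, m < t → ρ.pos t = τ.pos t := by
        intro ρ hρ t ht
        refine ih (n - t) ?_ t rfl ρ hρ
        have := t.isLt
        rw [Fin.lt_def] at ht
        omega
      clear ih
      intro ρ₀ hρ₀
      by_contra hne₀
      have hlt := h.col_lt (hsupp ρ₀ hρ₀).symm m (hag ρ₀ hρ₀) hne₀
      -- If `m + 1` were left of `m` in `τ`, the generator would fix `τ`, hence `v`, so `m` would be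
      -- no descent of `ρ₀`. But `ρ₀` has `m + 1` in the same box, one column left of `τ.pos m`, and
      -- its `m` lies weakly left of that.
      obtain ⟨s, hms, hsc, hs⟩ := h.exists_stretch m (by omega) (by
        intro t ht
        by_contra hcon
        obtain ⟨h1, h2⟩ := h m t ht (by omega)
        have htn := t.isLt
        let i : Fin (n - 1) := ⟨m, by omega⟩
        have hli : lo i = m := rfl
        have hhi : hi i = t := Fin.ext ht.symm
        have h3 : op i v = v := hfix i (op_fix i τ (by
          unfold IsDescent
          rw [hli, hhi]
          exact hcon))
        have h4 := not_isDescent_of_op_eq h3 hρ₀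
        unfold IsDescent at h4
        have h5 := hag ρ₀ hρ₀ t (by rw [Fin.lt_def]; omega)
        simp only [pos] at h5 h2 hlt
        rw [hli, hhi, h5] at h4
        omega)
      obtain ⟨j, hj⟩ : ∃ j : ℕ, (s : ℕ) = m + j := ⟨s - m, by rw [Fin.lt_def] at hms; omega⟩
      obtain ⟨x, g, -, -, hswap, hzero⟩ := exists_moving α σ m j (hj ▸ s.isLt)
      have hkill : ∀ ρ : SPCT α σ, (∀ t, m ≤ t → ρ.pos t = τ.pos t) → x • basis α σ ρ = 0 := by
        intro ρ hρ
        refine hzero ρ (fun t h1 h2 => ?_) ⟨s, hms, hj.le, Or.inl ?_⟩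
        · rw [hρ t h1.le, hρ m le_rfl]
          exact (hs t h1 (by rw [Fin.le_def]; omega)).1
        · have h1 := hρ s hms.le
          have h2 := hρ m le_rfl
          simp only [pos] at h1 h2 hsc
          rw [h1, h2]
          exact hsc
      have hmove : ∀ ρ : SPCT α σ, (basis α σ).repr v ρ ≠ 0 → ρ.pos m ≠ τ.pos m →
          ∃ ρ' : SPCT α σ, x • basis α σ ρ = basis α σ ρ' ∧ ρ'.entry = ρ.entry.trans g := by
        intro ρ hρ hne
        have hst := hsupp ρ hρ
        have hag := hag ρ hρ
        have hcol := h.col_lt hst.symm m hag hne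
        refine hswap ρ fun t h1 h2 => ?_
        obtain ⟨h3, h4⟩ := hs t h1 (by rw [Fin.le_def]; omega)
        have h5 := hag t h1
        unfold IsAttacking
        simp only [pos] at h3 h4 h5 hcol
        rw [pos, pos, h5]
        refine ⟨by omega, ?_⟩
        rintro (h6 | ⟨h6, h7⟩)
        · omega
        -- An attacked `t` can only lie in the column of `τ.pos m`, so `τ.pos m` is in a lower row
        -- than `t`, and hence than `ρ.pos m`.
        have h8 := h4 (by omega)
        have hup : ∀ b, m < τ.entry b → τ.entry b = ρ.entry b := by
          intro b hb
          have := hag _ hb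
          simp only [pos, Equiv.symm_apply_apply] at this
          exact ((Equiv.symm_apply_eq _).mp this)
        have hup' : ∀ b, m < ρ.entry b → τ.entry b = ρ.entry b := by
          intro b hb
          have := hag _ hb
          simp only [pos, Equiv.symm_apply_apply] at this
          exact ((Equiv.eq_symm_apply _).mp this)
        have h9 : ρ.entry (τ.pos m) < ρ.entry (ρ.pos m) := by
          rw [Equiv.apply_symm_apply]
          refine lt_of_le_of_ne ?_ fun he => hne ?_
          · by_contra hcon
            have := hup' (τ.pos m) (not_le.mp hcon)
            rw [Equiv.apply_symm_apply] at this
            exact hcon this.ge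
          · rw [pos, Equiv.symm_apply_eq]
            exact he.symm
        -- The triple condition in `ρ` gives a right neighbour `e` of `ρ.pos m` that exceeds `τ.pos
        -- m` in both tableaux. Its entry is then above `m`, against row decrease in `ρ`.
        obtain ⟨e, e1, e2, e3⟩ := ρ.exists_of_entry_lt (b := ρ.pos m) (c := τ.pos m)
          (h7.trans h8) (by simp only [pos]; omega) h9
        have h10 := (entry_lt_iff_of_st hst e2.symm).mp e3
        rw [Equiv.apply_symm_apply] at h10
        have h11 := ρ.entry_lt_of_row (b := ρ.pos m) (c := e) e1.symm (by simp only [pos] at *; omega)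
        rw [Equiv.apply_symm_apply, ← hup e h10] at h11
        exact absurd h10 h11.le.not_gt
      obtain ⟨ρ', hρ', hρe⟩ := hmove ρ₀ hρ₀ hne₀
      have hzero' : x • v = 0 := hann x (hkill τ fun _ _ => rfl)
      classical
      let _ := Fintype.ofFinite (SPCT α σ)
      -- Tableaux not killed by `x` are all relabelled by the same permutation `g`, so no other term
      -- can contribute to `ρ'`.
      have hcoef : (basis α σ).repr (x • v) ρ' = (basis α σ).repr v ρ₀ := by
        conv_lhs => rw [← (basis α σ).sum_repr v, smul_def, map_sum, map_sum, Finsupp.finsetSum_apply]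
        rw [Finset.sum_eq_single ρ₀]
        · rw [map_smul, map_smul, ← smul_def, hρ', Module.Basis.repr_self]
          simp
        · intro ρ _ hne
          by_cases h0 : (basis α σ).repr v ρ = 0
          · simp [h0]
          · rw [map_smul, map_smul, ← smul_def]
            by_cases hm' : ρ.pos m = τ.pos m
            · rw [hkill ρ fun t ht => ?_]
              · simp
              · rcases ht.eq_or_lt with rfl | ht
                · exact hm'
                · exact hag ρ h0 t ht
            · obtain ⟨ρ'', h1, h2⟩ := hmove ρ h0 hm'
              rw [h1, Module.Basis.repr_self, Finsupp.smul_apply, Finsupp.single_apply, if_neg,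
                smul_zero]
              rintro rfl
              rw [hρe] at h2
              refine hne (SPCT.ext (Equiv.ext fun b => ?_))
              have := Equiv.congr_fun h2 b
              simpa using this.symm
        · simp
      rw [hzero', map_zero] at hcoef
      exact hρ₀ hcoef.symm
  classical
  refine ⟨(basis α σ).repr v τ, (basis α σ).repr.injective ?_⟩
  ext ρ
  rw [map_smul, Module.Basis.repr_self, Finsupp.smul_apply, Finsupp.single_apply]
  by_cases hρ : (basis α σ).repr v ρ = 0
  · split_ifs with he
    · rw [he]
      simp
    · rw [hρ, smul_zero]
  · have := eq_of_symm fun t => hagree _ t rfl ρ hρ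
    subst this
    simp

/-! ### Splitting the source along a direct sum decomposition. -/

theorem mem_of_repr_ne_zero {E : Set (SPCT α σ)} {v : TabModule α σ}
    (hv : v ∈ Submodule.span ℂ (basis α σ '' E)) {ρ : SPCT α σ}
    (hρ : (basis α σ).repr v ρ ≠ 0) : ρ ∈ E :=
  (basis α σ).mem_span_image.mp hv (Finsupp.mem_support_iff.mpr hρ)

theorem eq_zero_of_add_eq_zero {R M : Type*} [Ring R] [AddCommGroup M] [Module R M]
    {p q : Submodule R M} (h : Disjoint p q) {a b : M} (ha : a ∈ p) (hb : b ∈ q)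
    (hab : a + b = 0) : a = 0 := by
  refine Submodule.disjoint_def.mp h a ha ?_
  rw [eq_neg_of_add_eq_zero_left hab]
  exact q.neg_mem hb

/-- The span of a class is indecomposable. -/
theorem isIndecomposable_classSubmodule {E : Set (SPCT α σ)} (hE : E ∈ SPCT.classes α σ) :
    IsIndecomposable (Alg n) (classSubmodule hE) := by
  obtain ⟨τ₀, hE₀⟩ := id hE
  obtain ⟨τ, hτ, hst⟩ := τ₀.exists_isSource
  have hmem : ∀ ρ, ρ ∈ E ↔ ρ.st = τ.st := by
    intro ρ
    rw [hE₀, hst]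
    rfl
  have hτE : basis α σ τ ∈ classSubmodule hE :=
    Submodule.subset_span ⟨τ, (hmem τ).mpr rfl, rfl⟩
  let t : classSubmodule hE := ⟨basis α σ τ, hτE⟩
  have htop : ∀ p : Submodule (Alg n) (classSubmodule hE), t ∈ p → p = ⊤ := by
    intro p hp
    have hspan : ∀ v ∈ Submodule.span ℂ (basis α σ '' E),
        v ∈ (p.map (classSubmodule hE).subtype).restrictScalars ℂ := by
      intro v hv
      refine Submodule.span_le.mpr ?_ hv
      rintro _ ⟨ρ, hρ, rfl⟩
      exact basis_mem_of_isSource hτ (p.map (classSubmodule hE).subtype)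
        (Submodule.mem_map_of_mem hp) ρ ((hmem ρ).mp hρ)
    rw [eq_top_iff]
    rintro ⟨v, hv⟩ -
    obtain ⟨w, hw, rfl⟩ := hspan v hv
    exact hw
  refine ⟨⟨t, 0, fun h => (basis α σ).ne_zero τ (congrArg Subtype.val h)⟩, fun p q hpq => ?_⟩
  have hdis : ∀ a ∈ p, ∀ b ∈ q, a + b = 0 → a = 0 := by
    intro a ha b hb hab
    exact eq_zero_of_add_eq_zero (R := Alg n) (M := classSubmodule hE) hpq.disjoint ha hb hab
  obtain ⟨a, ha, b, hb, hab⟩ := Submodule.mem_sup.mp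
    (hpq.sup_eq_top ▸ Submodule.mem_top : t ∈ p ⊔ q)
  -- If `x` kills `t = a + b`, then `x • a` and `x • b` sum to zero in a direct sum.
  have hann : ∀ x : Alg n, x • t = 0 → x • a = 0 := by
    intro x hx
    refine hdis _ (p.smul_mem x ha) _ (q.smul_mem x hb) ?_
    rw [← smul_add, hab, hx]
  obtain ⟨c, hc⟩ := eq_smul_of_isSource hτ (v := (a : TabModule α σ))
    (fun ρ hρ => (hmem ρ).mp (mem_of_repr_ne_zero a.2 hρ))
    (fun x hx => congrArg Subtype.val (hann x (Subtype.ext hx)))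
    -- Being fixed by a generator is annihilation by `gen i - 1`, so it passes from `t` to `a` as
    -- well.
    (fun i hi => by
      have h1 : (gen i - 1 : Alg n) • t = 0 := by
        apply Subtype.ext
        change (gen i - 1 : Alg n) • basis α σ τ = 0
        rw [sub_smul, one_smul, gen_smul, hi, sub_self]
      have h2 : (gen i - 1 : Alg n) • (a : TabModule α σ) = 0 :=
        congrArg Subtype.val (hann _ h1)
      rwa [sub_smul, one_smul, gen_smul, sub_eq_zero] at h2)
  have hca : a = algebraMap ℂ (Alg n) c • t := by
    apply Subtype.ext
    rw [hc]
    exact (algebraMap_smul (Alg n) c (basis α σ τ)).symm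
  -- For `c = 0` the generating vector `t` equals `b` and lies in `q`; otherwise it is a multiple of
  -- `a` and lies in `p`.
  by_cases h0 : c = 0
  · left
    have h1 : a = 0 := by rw [hca, h0, map_zero, zero_smul]
    rw [h1, zero_add] at hab
    have h2 := htop q (hab ▸ hb)
    subst h2
    simpa using hpq.disjoint.eq_bot
  · right
    have h1 : t = algebraMap ℂ (Alg n) c⁻¹ • a := by
      rw [hca, smul_smul, ← map_mul, inv_mul_cancel₀ h0, map_one, one_smul]
    have h2 := htop p (h1 ▸ p.smul_mem _ ha)
    subst h2
    simpa using hpq.disjoint.eq_bot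

end TabModule

end ZeroHecke

end

theorem theorem3p1 (n : ℕ) (α : Composition n) (σ : Equiv.Perm (Fin α.length))
    (E : Set (ZeroHecke.SPCT α σ)) (hE : E ∈ ZeroHecke.SPCT.classes α σ) :
    ZeroHecke.IsIndecomposable (ZeroHecke.Alg n) (ZeroHecke.TabModule.classSubmodule hE) :=
  ZeroHecke.TabModule.isIndecomposable_classSubmodule hE
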